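/- Call a family of rationals computable if numerators and denominators are computable functions of the index. A left-c.e. approximation to a real $\alpha$ is a computable sequence of rationals $(\alpha_s)$ that converges to $\alpha$ and satisfies $\alpha_s\le\alpha$ for almost all $s$; it is monotone if $\alpha_s\le\alpha_{s+1}$ for all $s$. A real is left-c.e. if it has a monotone left-c.e. approximation. A Martin-Löf test is a sequence $(U_i)_{i\in\mathbb N}$ of subsets of $\mathbb R$ of the form $U_i=\bigcup_k (l_{i,k},r_{i,k})$, with $(l_{i,k})$ and $(r_{i,k})$ computable double sequences of rationals, such that $U_i$ has Lebesgue measure at most $2^{-i}$; a real is Martin-Löf random if it lies in $\bigcap_i U_i$ for no Martin-Löf test $(U_i)$. For reals $\alpha,\beta$ put $$\mathcal D(\alpha,\beta)=\inf\{\,q\in\mathbb Q,\ q>0 \;:\; q\beta-\alpha \text{ is a left-c.e. real}\,\}.$$ **Theorem.** Let $\alpha,\beta$ be Martin-Löf random left-c.e. reals. Then the set defining $\mathcal D(\alpha,\beta)$ is nonempty and $\mathcal D(\alpha,\beta)>0$, and for any monotone left-c.e. approximations $(\alpha_s)$, $(\beta_s)$ to $\alpha$ and $\beta$ respectively, $$\lim_{s\to\infty}\frac{\alpha-\alpha_s}{\beta-\beta_s}\quad\text{exists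 and equals }\mathcal D(\alpha,\beta);$$ in particular the limit does not depend on the approximations. Moreover, for every Martin-Löf random left-c.e. real $\gamma$ and every positive rational $q$: 1. $\mathcal D(\alpha+\beta,\gamma)=\mathcal D(\alpha,\gamma)+\mathcal D(\beta,\gamma)$; 2. $\mathcal D(\alpha,q\beta)=\frac1q\,\mathcal D(\alpha,\beta)$ and $\mathcal D(q\alpha,\beta)=q\,\mathcal D(\alpha,\beta)$; 3. $\mathcal D(\alpha,\beta)\cdot\mathcal D(\beta,\alpha)=1$. -/

import Mathlib

open Filter Topology MeasureTheory

/-- A family of rationals indexed by a type of codes is computable if numerators (written as a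
difference of two natural numbers) and positive denominators can be computed from the index. -/
def ComputableRat {ι : Type} [Primcodable ι] (a : ι → ℚ) : Prop :=
  ∃ f g h : ι → ℕ, Computable f ∧ Computable g ∧ Computable h ∧
    ∀ i, a i = ((f i : ℚ) - (g i : ℚ)) / ((h i : ℚ) + 1)

/-- A left-c.e. approximation to the real `α`: a computable sequence of rationals which converges
to `α` and almost all of whose terms are at most `α`. -/
structure IsLeftCEApprox (a : ℕ → ℚ) (α : ℝ) : Prop where
  computable : ComputableRat a
  tendsto : Tendsto (fun s => (a s : ℝ)) atTop (𝓝 α)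
  eventually_le : ∀ᶠ s in atTop, (a s : ℝ) ≤ α

/-- A real is left-c.e. if it is the limit of a computable nondecreasing sequence of rationals. -/
def IsLeftCE (α : ℝ) : Prop :=
  ∃ a : ℕ → ℚ, IsLeftCEApprox a α ∧ Monotone a

/-- A Martin-Löf test: a uniform sequence of effectively open sets of reals (each the union of a
list of rational open intervals, computable uniformly in the index; an interval whose left
endpoint is not below its right endpoint is empty), the `i`-th of Lebesgue measure at most
`2⁻ⁱ`. -/
structure IsMartinLofTest (U : ℕ → Set ℝ) : Prop where
  effectivelyOpen : ∃ l r : ℕ × ℕ → ℚ, ComputableRat l ∧ ComputableRat r ∧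
    ∀ i, U i = ⋃ k, Set.Ioo (l (i, k) : ℝ) (r (i, k) : ℝ)
  volume_le : ∀ i, volume (U i) ≤ (2⁻¹ : ENNReal) ^ i

/-- A real is Martin-Löf random if no Martin-Löf test captures it. -/
def IsMartinLofRandom (α : ℝ) : Prop :=
  ∀ U : ℕ → Set ℝ, IsMartinLofTest U → α ∉ ⋂ i, U i

/-- The positive rationals `q` (as reals) such that `q β - α` is a left-c.e. real. -/
def leftCEFactors (α β : ℝ) : Set ℝ :=
  {x | ∃ q : ℚ, 0 < q ∧ IsLeftCE ((q : ℝ) * β - α) ∧ x = (q : ℝ)}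

/-- `𝒟(α, β) = inf {q ∈ ℚ⁺ | q β - α is a left-c.e. real}`. -/
noncomputable def calD (α β : ℝ) : ℝ :=
  sInf (leftCEFactors α β)

/-! The core is that (α - α_s)/(β - β_s) converges whenever β is random. Suppose the ratio is
infinitely often below c and infinitely often above c + 1. For each guess x of β, let a trader hold
at most one share; at stage s a sale yields f_s = α_s - cβ_s and a purchase costs f_s + (x - β_s).
For x slightly above β every oscillation offers a profitable round trip. The best cash value grows
no faster than α_s while β_s ≤ x, so its growth is bounded. Yet each purchase costs r - p more at r
than at p, so many oscillations make the cash value, as a function of x, arbitrarily steep just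
above β. A process that sweeps rightwards and covers only steep stretches uses little length and
still passes β, which contradicts randomness (`not_isMartinLofRandom_of_slope`). Rescaling handles
arbitrary gaps (`not_oscillating`), and one trade with a large fee bounds the ratio
(`exists_eventually_le_mul`).

Convergence forces any two monotone approximations of β to have ratio tending to 1
(`tendsto_ratio_one`), by comparing one with a delayed copy of the other. The limit is then the
infimum: if q exceeds it, qβ_s - α_s approximates qβ - α from below; if d_s increases to qβ - α,
then (α_s + d_s)/q approximates β at the standard rate, so q is at least the limit. Most algebraic
laws are limit computations, and positivity follows from inversion. -/

/-- The rational denoted by a triple of natural numbers. -/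
def ratVal (c : ℕ × ℕ × ℕ) : ℚ := ((c.1 : ℚ) - (c.2.1 : ℚ)) / ((c.2.2 : ℚ) + 1)

theorem ratVal_surjective (q : ℚ) : ∃ c, ratVal c = q := by
  refine ⟨(q.num.toNat, (-q.num).toNat, q.den - 1), ?_⟩
  have h1 : ((q.num.toNat : ℤ) : ℚ) - (((-q.num).toNat : ℤ) : ℚ) = (q.num : ℚ) := by
    rw [← Int.cast_sub]; congr 1; omega
  have h2 : ((q.den - 1 : ℕ) : ℚ) + 1 = q.den := by
    have := q.den_pos
    rw [← Nat.cast_succ]; congr 1; omega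
  simp only [ratVal]
  rw [h2]
  have h3 := Rat.num_div_den q
  rw [← h1] at h3
  exact_mod_cast h3

/-! ### Closure properties of computable families of rationals. -/

section Computability

variable {ι κ : Type} [Primcodable ι] [Primcodable κ]

theorem computableRat_iff {a : ι → ℚ} :
    ComputableRat a ↔ ∃ F : ι → ℕ × ℕ × ℕ, Computable F ∧ ∀ i, a i = ratVal (F i) := by
  constructor
  · rintro ⟨f, g, h, hf, hg, hh, H⟩
    exact ⟨fun i => (f i, g i, h i), hf.pair (hg.pair hh), H⟩
  · rintro ⟨F, hF, H⟩
    exact ⟨_, _, _, Computable.fst.comp hF, Computable.fst.comp (Computable.snd.comp hF),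
      Computable.snd.comp (Computable.snd.comp hF), H⟩

theorem computableRat_ratVal {F : ι → ℕ × ℕ × ℕ} (hF : Computable F) :
    ComputableRat (fun i => ratVal (F i)) :=
  computableRat_iff.2 ⟨F, hF, fun _ => rfl⟩

theorem computableRat_const (q : ℚ) : ComputableRat (fun _ : ι => q) := by
  obtain ⟨c, rfl⟩ := ratVal_surjective q
  exact computableRat_ratVal (Computable.const c)

theorem computableRat_natCast {f : ι → ℕ} (hf : Computable f) :
    ComputableRat (fun i => (f i : ℚ)) :=
  ⟨f, fun _ => 0, fun _ => 0, hf, Computable.const _, Computable.const _, fun i => by simp⟩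

theorem ComputableRat.comp {a : κ → ℚ} (ha : ComputableRat a) {φ : ι → κ} (hφ : Computable φ) :
    ComputableRat (fun i => a (φ i)) := by
  obtain ⟨F, hF, H⟩ := computableRat_iff.1 ha
  exact computableRat_iff.2 ⟨_, hF.comp hφ, fun i => H _⟩

/-- Substitution of a computable rational into a function of a coded rational. -/
theorem ComputableRat.subst {H : κ → ℚ → ℚ}
    (hH : ComputableRat (fun q : κ × (ℕ × ℕ × ℕ) => H q.1 (ratVal q.2)))
    {φ : ι → κ} (hφ : Computable φ) {x : ι → ℚ} (hx : ComputableRat x) :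
    ComputableRat (fun i => H (φ i) (x i)) := by
  obtain ⟨F, hF, hxF⟩ := computableRat_iff.1 hx
  simpa only [hxF] using hH.comp (hφ.pair hF)

theorem computable_nat_add {f g : ι → ℕ} (hf : Computable f) (hg : Computable g) :
    Computable (fun i => f i + g i) := Primrec.nat_add.to_comp.comp hf hg

theorem computable_nat_mul {f g : ι → ℕ} (hf : Computable f) (hg : Computable g) :
    Computable (fun i => f i * g i) := Primrec.nat_mul.to_comp.comp hf hg

theorem ComputableRat.add {x y : ι → ℚ} (hx : ComputableRat x) (hy : ComputableRat y) :
    ComputableRat (fun i => x i + y i) := by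
  obtain ⟨f, g, h, hf, hg, hh, H⟩ := hx
  obtain ⟨f', g', h', hf', hg', hh', H'⟩ := hy
  have hs := Computable.succ.comp hh
  have hs' := Computable.succ.comp hh'
  -- Denominators are stored minus one, and hh' + h + h' + 1 = (h + 1)(h' + 1).
  refine ⟨fun i => f i * (h' i).succ + f' i * (h i).succ,
    fun i => g i * (h' i).succ + g' i * (h i).succ, fun i => h i * h' i + (h i + h' i),
    computable_nat_add (computable_nat_mul hf hs') (computable_nat_mul hf' hs),
    computable_nat_add (computable_nat_mul hg hs') (computable_nat_mul hg' hs),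
    computable_nat_add (computable_nat_mul hh hh') (computable_nat_add hh hh'), fun i => ?_⟩
  dsimp only
  rw [H, H']
  push_cast
  have : ((h i : ℚ) * h' i + (h i + h' i) + 1) = (h i + 1) * (h' i + 1) := by ring
  rw [this]
  field_simp
  ring

theorem ComputableRat.neg {x : ι → ℚ} (hx : ComputableRat x) :
    ComputableRat (fun i => -x i) := by
  obtain ⟨f, g, h, hf, hg, hh, H⟩ := hx
  exact ⟨g, f, h, hg, hf, hh, fun i => by dsimp only; rw [H]; ring⟩

theorem ComputableRat.sub {x y : ι → ℚ} (hx : ComputableRat x) (hy : ComputableRat y) :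
    ComputableRat (fun i => x i - y i) := by
  simpa only [sub_eq_add_neg] using hx.add hy.neg

theorem ComputableRat.mul {x y : ι → ℚ} (hx : ComputableRat x) (hy : ComputableRat y) :
    ComputableRat (fun i => x i * y i) := by
  obtain ⟨f, g, h, hf, hg, hh, H⟩ := hx
  obtain ⟨f', g', h', hf', hg', hh', H'⟩ := hy
  refine ⟨fun i => f i * f' i + g i * g' i,
    fun i => f i * g' i + g i * f' i, fun i => h i * h' i + (h i + h' i),
    computable_nat_add (computable_nat_mul hf hf') (computable_nat_mul hg hg'),
    computable_nat_add (computable_nat_mul hf hg') (computable_nat_mul hg hf'),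
    computable_nat_add (computable_nat_mul hh hh') (computable_nat_add hh hh'), fun i => ?_⟩
  dsimp only
  rw [H, H']
  push_cast
  have : ((h i : ℚ) * h' i + (h i + h' i) + 1) = (h i + 1) * (h' i + 1) := by ring
  rw [this]
  field_simp
  ring

theorem ComputableRat.decide_le {x y : ι → ℚ} (hx : ComputableRat x) (hy : ComputableRat y) :
    Computable (fun i => decide (x i ≤ y i)) := by
  obtain ⟨f, g, h, hf, hg, hh, H⟩ := hx
  obtain ⟨f', g', h', hf', hg', hh', H'⟩ := hy
  have hs := Computable.succ.comp hh
  have hs' := Computable.succ.comp hh'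
  -- Cross-multiplied with the subtracted terms moved across, so that the comparison takes place in
  -- ℕ.
  have key := (Primrec.nat_le.decide.to_comp).comp
    (computable_nat_add (computable_nat_mul hf hs') (computable_nat_mul hg' hs))
    (computable_nat_add (computable_nat_mul hf' hs) (computable_nat_mul hg hs'))
  refine key.of_eq fun i => ?_
  rw [H, H', decide_eq_decide, div_le_div_iff₀ (by positivity) (by positivity),
    ← Nat.cast_le (α := ℚ)]
  push_cast
  constructor <;> intro h <;> linarith

theorem ComputableRat.cond {c : ι → Bool} {x y : ι → ℚ} (hc : Computable c)
    (hx : ComputableRat x) (hy : ComputableRat y) :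
    ComputableRat (fun i => bif c i then x i else y i) := by
  obtain ⟨F, hF, hxF⟩ := computableRat_iff.1 hx
  obtain ⟨G, hG, hyG⟩ := computableRat_iff.1 hy
  refine computableRat_iff.2 ⟨_, Computable.cond hc hF hG, fun i => ?_⟩
  cases h : c i <;> simp [hxF, hyG]

theorem ComputableRat.max {x y : ι → ℚ} (hx : ComputableRat x) (hy : ComputableRat y) :
    ComputableRat (fun i => max (x i) (y i)) := by
  have h := ComputableRat.cond (hx.decide_le hy) hy hx
  convert h using 2 with i
  by_cases hxy : x i ≤ y i
  · simp [hxy]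
  · simp [hxy, le_of_not_ge hxy]

theorem computable_rec {σ : Type} [Primcodable σ] {F0 : ι → σ} {S : (ι × ℕ) × σ → σ}
    (hF0 : Computable F0) (hS : Computable S) :
    Computable (fun z : ι × ℕ =>
      (Nat.rec (F0 z.1) (fun n c => S ((z.1, n), c)) z.2 : σ)) := by
  have hstep : Computable (fun q : (ι × ℕ) × (ℕ × σ) => (((q.1.1, q.2.1) : ι × ℕ), q.2.2)) :=
    ((Computable.fst.comp Computable.fst).pair (Computable.fst.comp Computable.snd)).pair
      (Computable.snd.comp Computable.snd)
  have h₂ : Computable₂ (fun (z : ι × ℕ) (q : ℕ × σ) => S ((z.1, q.1), q.2)) :=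
    (hS.comp hstep : Computable (fun q : (ι × ℕ) × (ℕ × σ) => S ((q.1.1, q.2.1), q.2.2)))
  have h₁ : Computable (fun z : ι × ℕ => F0 z.1) := hF0.comp Computable.fst
  have h₀ : Computable (fun z : ι × ℕ => z.2) := Computable.snd
  exact Computable.nat_rec h₀ h₁ h₂

/-- Simultaneous primitive recursion of two rational sequences. -/
theorem computableRat_rec₂ {F G : ι → ℕ → ℚ}
    {S T : ι × ℕ → (ℕ × ℕ × ℕ) × (ℕ × ℕ × ℕ) → ℚ}
    (hF : ComputableRat (fun i => F i 0)) (hG : ComputableRat (fun i => G i 0))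
    (hS : ComputableRat (fun z : (ι × ℕ) × ((ℕ × ℕ × ℕ) × (ℕ × ℕ × ℕ)) => S z.1 z.2))
    (hT : ComputableRat (fun z : (ι × ℕ) × ((ℕ × ℕ × ℕ) × (ℕ × ℕ × ℕ)) => T z.1 z.2))
    (hFS : ∀ i n c d, F i n = ratVal c → G i n = ratVal d → F i (n + 1) = S (i, n) (c, d))
    (hGT : ∀ i n c d, F i n = ratVal c → G i n = ratVal d → G i (n + 1) = T (i, n) (c, d)) :
    ComputableRat (fun z : ι × ℕ => F z.1 z.2) ∧ ComputableRat (fun z : ι × ℕ => G z.1 z.2) := by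
  obtain ⟨F0, hF0, HF⟩ := computableRat_iff.1 hF
  obtain ⟨G0, hG0, HG⟩ := computableRat_iff.1 hG
  obtain ⟨S', hS', HS⟩ := computableRat_iff.1 hS
  obtain ⟨T', hT', HT⟩ := computableRat_iff.1 hT
  -- The recursion runs on codes. The hypotheses `hFS` and `hGT` accept every code of the current
  -- values, so no canonical code is needed.
  let R : ι × ℕ → (ℕ × ℕ × ℕ) × (ℕ × ℕ × ℕ) := fun z =>
    Nat.rec (F0 z.1, G0 z.1) (fun n c => (S' ((z.1, n), c), T' ((z.1, n), c))) z.2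
  have hR : Computable R :=
    computable_rec (F0 := fun i => (F0 i, G0 i)) (S := fun z => (S' z, T' z))
      (hF0.pair hG0) (hS'.pair hT')
  have key : ∀ i n, F i n = ratVal (R (i, n)).1 ∧ G i n = ratVal (R (i, n)).2 := by
    intro i n
    induction n with
    | zero => exact ⟨HF i, HG i⟩
    | succ n ih =>
      exact ⟨(hFS i n _ _ ih.1 ih.2).trans (HS ((i, n), R (i, n))),
        (hGT i n _ _ ih.1 ih.2).trans (HT ((i, n), R (i, n)))⟩
  exact ⟨computableRat_iff.2 ⟨_, Computable.fst.comp hR, fun z => (key z.1 z.2).1⟩,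
    computableRat_iff.2 ⟨_, Computable.snd.comp hR, fun z => (key z.1 z.2).2⟩⟩

theorem computableRat_rec {F : ι → ℕ → ℚ} {S : ι × ℕ → ℕ × ℕ × ℕ → ℚ}
    (hF : ComputableRat (fun i => F i 0))
    (hS : ComputableRat (fun z : (ι × ℕ) × (ℕ × ℕ × ℕ) => S z.1 z.2))
    (hFS : ∀ i n c, F i n = ratVal c → F i (n + 1) = S (i, n) c) :
    ComputableRat (fun z : ι × ℕ => F z.1 z.2) := by
  have hS₂ := hS.comp (φ := fun z : (ι × ℕ) × ((ℕ × ℕ × ℕ) × (ℕ × ℕ × ℕ)) => (z.1, z.2.1))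
    (Computable.fst.pair (Computable.fst.comp Computable.snd))
  exact (computableRat_rec₂ (S := fun z c => S z c.1) (T := fun z c => S z c.1) hF hF hS₂ hS₂
    (fun i n c _ h _ => hFS i n c h) (fun i n c _ h _ => hFS i n c h)).1

theorem computable_two_pow : Computable (fun n : ℕ => 2 ^ n) := by
  have h : Primrec (fun n : ℕ => (Nat.rec 1 (fun _ c => 2 * c) n : ℕ)) :=
    Primrec.nat_rec₁ (f := fun _ c => 2 * c) 1
      (Primrec.nat_mul.comp (Primrec.const 2) Primrec.snd)
  refine h.to_comp.of_eq fun n => ?_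
  induction n with
  | zero => rfl
  | succ n ih => simp only [ih]; ring

/-- An enumeration of the rationals in which each one occurs infinitely often. -/
def ratEnum (i : ℕ) : ℚ := ratVal (Denumerable.ofNat (ℕ × ℕ × ℕ) i.unpair.1)

theorem computableRat_ratEnum : ComputableRat ratEnum :=
  computableRat_ratVal ((Primrec.ofNat (ℕ × ℕ × ℕ)).to_comp.comp
    (Computable.fst.comp Primrec.unpair.to_comp))

theorem exists_ratEnum_eq (q : ℚ) (N : ℕ) : ∃ i ≥ N, ratEnum i = q := by
  obtain ⟨c, rfl⟩ := ratVal_surjective q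
  refine ⟨Nat.pair (Encodable.encode c) N, Nat.right_le_pair _ _, ?_⟩
  rw [ratEnum, Nat.unpair_pair, Denumerable.ofNat_encode]

end Computability

/-! ### Covering by potentials, and the resulting Martin-Löf test. -/

/-- The left-to-right covering process of a sequence of potentials `A`: after stage `i` the
coverEnd moves to the `i`-th rational whenever `A i` falls up to there with slope at least `K`. -/
def coverEnd (b : ℕ → ℚ) (K : ℚ) (A : ℕ → ℚ → ℚ) : ℕ → ℚ
  | 0 => b 0
  | i + 1 =>
    bif decide (ratEnum i ≤ max (coverEnd b K A i) (b i)) ||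
        !decide (K * (ratEnum i - max (coverEnd b K A i) (b i)) ≤
          A i (max (coverEnd b K A i) (b i)) - A i (ratEnum i))
      then max (coverEnd b K A i) (b i) else ratEnum i

section Cover

variable {b v : ℕ → ℚ} {K : ℚ} {A : ℕ → ℚ → ℚ}

theorem coverEnd_succ_cases (b : ℕ → ℚ) (K : ℚ) (A : ℕ → ℚ → ℚ) (i : ℕ) :
    coverEnd b K A (i + 1) = max (coverEnd b K A i) (b i) ∨
    (coverEnd b K A (i + 1) = ratEnum i ∧ max (coverEnd b K A i) (b i) < ratEnum i ∧
      K * (ratEnum i - max (coverEnd b K A i) (b i)) ≤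
          A i (max (coverEnd b K A i) (b i)) - A i (ratEnum i)) := by
  rw [coverEnd]
  generalize max (coverEnd b K A i) (b i) = p
  by_cases h1 : ratEnum i ≤ p
  · simp [h1]
  by_cases h2 : K * (ratEnum i - p) ≤ A i p - A i (ratEnum i)
  · right; simp only [h1, h2]; simpa using h1
  · left; simp [h1, h2]

theorem coverEnd_succ_of_slope {i : ℕ} (h1 : max (coverEnd b K A i) (b i) < ratEnum i)
    (h2 : K * (ratEnum i - max (coverEnd b K A i) (b i)) ≤
          A i (max (coverEnd b K A i) (b i)) - A i (ratEnum i)) :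
    coverEnd b K A (i + 1) = ratEnum i := by
  rw [coverEnd]
  simp [h1.not_ge, h2]

theorem max_le_coverEnd_succ (i : ℕ) :
    max (coverEnd b K A i) (b i) ≤ coverEnd b K A (i + 1) := by
  rcases coverEnd_succ_cases b K A i with h | ⟨h, h', -⟩
  · exact h.ge
  · exact h ▸ h'.le

/-- The potential at the current position is a budget: a jump of length ℓ spends at least Kℓ of it,
moving right without a jump never raises it, and a stage adds at most the increment of `v`. -/
theorem coverEnd_sum_le (hA0 : ∀ x, A 0 x = 0) (hA : ∀ n x, 0 ≤ A n x)
    (hanti : ∀ n, Antitone (A n))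
    (hstep : ∀ n x, b (n + 1) ≤ x → A (n + 1) x ≤ A n x + (v (n + 1) - v n)) (n : ℕ) :
    K * ∑ i ∈ Finset.range n, (coverEnd b K A (i + 1) - max (coverEnd b K A i) (b i))
      ≤ v n - v 0 := by
  have key : ∀ n, K * ∑ i ∈ Finset.range n,
      (coverEnd b K A (i + 1) - max (coverEnd b K A i) (b i))
      + A n (max (coverEnd b K A n) (b n)) ≤ v n - v 0 := by
    intro n
    induction n with
    | zero => simp [hA0]
    | succ n ih =>
      rw [Finset.sum_range_succ, mul_add]
      have h1 := hstep n (max (coverEnd b K A (n + 1)) (b (n + 1))) (le_max_right _ _)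
      have h2 := hanti n (le_max_left (coverEnd b K A (n + 1)) (b (n + 1)))
      have h3 : K * (coverEnd b K A (n + 1) - max (coverEnd b K A n) (b n)) +
          A n (coverEnd b K A (n + 1)) ≤ A n (max (coverEnd b K A n) (b n)) := by
        rcases coverEnd_succ_cases b K A n with h | ⟨h, -, h'⟩
        · rw [h]; simp
        · rw [h]; linarith
      linarith
  linarith [key n, hA n (max (coverEnd b K A n) (b n))]

/-- Once the potential is steep just right of β, any rational there is accepted when it is next
enumerated, wherever the process stands. So the process passes β, and since each `b n` is below β
the first crossing happens by a jump. -/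
theorem exists_coverEnd_covers {β : ℝ} (hb : ∀ n, (b n : ℝ) < β) (hβ : ∀ q : ℚ, (q : ℝ) ≠ β)
    {r₀ : ℝ} (hr₀ : β < r₀) {N : ℕ}
    (hslope : ∀ n ≥ N, ∀ r : ℚ, β < r → (r : ℝ) < r₀ → ∀ p ≤ r, K * (r - p) ≤ A n p - A n r) :
    ∃ i, β ∈ Set.Ioo ((max (coverEnd b K A i) (b i) : ℚ) : ℝ) (coverEnd b K A (i + 1) : ℝ) := by
  have hcross : ∃ i, β < coverEnd b K A i := by
    obtain ⟨r, hr, hr'⟩ := exists_rat_btwn hr₀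
    obtain ⟨i, hi, hir⟩ := exists_ratEnum_eq r N
    by_cases h : max (coverEnd b K A i) (b i) < r
    · refine ⟨i + 1, ?_⟩
      rw [coverEnd_succ_of_slope (by rwa [hir]) (by rw [hir]; exact hslope i hi r hr hr' _ h.le),
        hir]
      exact hr
    · refine ⟨i + 1, hr.trans_le ?_⟩
      exact_mod_cast (not_lt.1 h).trans (max_le_coverEnd_succ i)
  classical
  obtain ⟨i, hi⟩ : ∃ i, Nat.find hcross = i + 1 := by
    refine Nat.exists_eq_succ_of_ne_zero fun h => ?_
    have := Nat.find_spec hcross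
    rw [h, coverEnd] at this
    exact absurd this (hb 0).not_gt
  refine ⟨i, lt_of_le_of_ne ?_ (hβ _), hi ▸ Nat.find_spec hcross⟩
  rw [Rat.cast_max]
  exact max_le (not_lt.1 (Nat.find_min hcross (m := i) (by omega))) (hb i).le

end Cover

theorem computableRat_coverEnd {b : ℕ → ℚ} (hb : ComputableRat b) {K : ℕ → ℚ}
    (hK : ComputableRat K) {A : ℕ → ℕ → ℚ → ℚ}
    (hA : ComputableRat (fun z : (ℕ × ℕ) × (ℕ × ℕ × ℕ) => A z.1.1 z.1.2 (ratVal z.2))) :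
    ComputableRat (fun z : ℕ × ℕ => coverEnd b (K z.1) (A z.1) z.2) := by
  refine computableRat_rec (F := fun j => coverEnd b (K j) (A j)) (S := fun z c =>
      bif decide (ratEnum z.2 ≤ max (ratVal c) (b z.2)) ||
        !decide (K z.1 * (ratEnum z.2 - max (ratVal c) (b z.2)) ≤
          A z.1 z.2 (max (ratVal c) (b z.2)) - A z.1 z.2 (ratEnum z.2))
      then max (ratVal c) (b z.2) else ratEnum z.2) (computableRat_const (b 0)) ?_ ?_
  · have hi : Computable (fun z : (ℕ × ℕ) × (ℕ × ℕ × ℕ) => z.1.2) :=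
      Computable.snd.comp Computable.fst
    have hj : Computable (fun z : (ℕ × ℕ) × (ℕ × ℕ × ℕ) => z.1.1) :=
      Computable.fst.comp Computable.fst
    have he : ComputableRat (fun z : (ℕ × ℕ) × (ℕ × ℕ × ℕ) => ratEnum z.1.2) :=
      computableRat_ratEnum.comp hi
    have hp : ComputableRat (fun z : (ℕ × ℕ) × (ℕ × ℕ × ℕ) => max (ratVal z.2) (b z.1.2)) :=
      (computableRat_ratVal Computable.snd).max (hb.comp hi)
    have hAp := ComputableRat.subst (H := fun q : ℕ × ℕ => A q.1 q.2) hA Computable.fst hp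
    have hAe := ComputableRat.subst (H := fun q : ℕ × ℕ => A q.1 q.2) hA Computable.fst he
    refine ComputableRat.cond ?_ hp he
    exact Primrec.or.to_comp.comp (he.decide_le hp) (Primrec.not.to_comp.comp
      (((hK.comp hj).mul (he.sub hp)).decide_le (hAp.sub hAe)))
  · intro j n c h
    dsimp only at h ⊢
    rw [coverEnd, h]

theorem tsum_ofReal_le_of_sum_le {u : ℕ → ℝ} (hu : ∀ i, 0 ≤ u i) {c : ℝ}
    (h : ∀ n, ∑ i ∈ Finset.range n, u i ≤ c) : ∑' i, ENNReal.ofReal (u i) ≤ ENNReal.ofReal c := by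
  refine ENNReal.tsum_le_of_sum_range_le fun n => ?_
  rw [← ENNReal.ofReal_sum_of_nonneg fun i _ => hu i]
  exact ENNReal.ofReal_le_ofReal (h n)

/-- A test obtained from a double sequence of intervals with small total lengths. -/
theorem isMartinLofTest_of_sum_le {l r : ℕ × ℕ → ℚ} (hl : ComputableRat l) (hr : ComputableRat r)
    (hlr : ∀ z, l z ≤ r z)
    (hsum : ∀ j n, 2 ^ j * ∑ i ∈ Finset.range n, (r (j, i) - l (j, i)) ≤ 1) :
    IsMartinLofTest (fun j => ⋃ i, Set.Ioo (l (j, i) : ℝ) (r (j, i) : ℝ)) := by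
  refine ⟨⟨l, r, hl, hr, fun _ => rfl⟩, fun j => ?_⟩
  refine (measure_iUnion_le _).trans ?_
  simp only [Real.volume_Ioo]
  have h2 : (2⁻¹ : ENNReal) ^ j = ENNReal.ofReal ((2⁻¹ : ℝ) ^ j) := by
    rw [ENNReal.ofReal_pow (by norm_num), ENNReal.ofReal_inv_of_pos (by norm_num)]
    norm_num
  rw [h2]
  refine tsum_ofReal_le_of_sum_le (fun i => ?_) fun n => ?_
  · exact sub_nonneg.2 (by exact_mod_cast hlr (j, i))
  · have h3 : (2 : ℝ) ^ j * ∑ i ∈ Finset.range n, ((r (j, i) : ℝ) - l (j, i)) ≤ 1 := by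
      exact_mod_cast hsum j n
    rw [inv_pow, ← one_div, le_div_iff₀ (by positivity)]
    linarith

theorem computableRat_two_pow : ComputableRat (fun n : ℕ => (2 : ℚ) ^ n) := by
  simpa using computableRat_natCast computable_two_pow

theorem IsMartinLofRandom.ratCast_ne {β : ℝ} (hβ : IsMartinLofRandom β) (q : ℚ) :
    (q : ℝ) ≠ β := by
  rintro rfl
  have hδ : ComputableRat (fun z : ℕ × ℕ => (1 / 2 : ℚ) * (1 / 2 ^ z.1)) := by
    have hinv : ComputableRat (fun n : ℕ => (1 : ℚ) / 2 ^ n) :=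
      ⟨fun _ => 1, fun _ => 0, fun n => 2 ^ n - 1, Computable.const _, Computable.const _,
        Primrec.nat_sub.to_comp.comp computable_two_pow (Computable.const 1), fun n => by
          have : 1 ≤ 2 ^ n := Nat.one_le_two_pow
          push_cast [Nat.cast_sub this]
          simp⟩
    exact (computableRat_const _).mul (hinv.comp Computable.fst)
  have hq := computableRat_const (ι := ℕ × ℕ) q
  refine hβ (fun j => ⋃ _ : ℕ, Set.Ioo ((q - (1 / 2 : ℚ) * (1 / 2 ^ j) : ℚ) : ℝ)
    ((q + (1 / 2 : ℚ) * (1 / 2 ^ j) : ℚ) : ℝ))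
    ⟨⟨_, _, hq.sub hδ, hq.add hδ, fun _ => rfl⟩, fun j => ?_⟩ ?_
  · rw [Set.iUnion_const, Real.volume_Ioo]
    have h2 : (2⁻¹ : ENNReal) ^ j = ENNReal.ofReal ((2⁻¹ : ℝ) ^ j) := by
      rw [ENNReal.ofReal_pow (by norm_num), ENNReal.ofReal_inv_of_pos (by norm_num)]
      norm_num
    rw [h2]
    refine ENNReal.ofReal_le_ofReal (le_of_eq ?_)
    push_cast
    rw [inv_pow]
    ring
  · simp only [Set.iUnion_const, Set.mem_iInter, Set.mem_Ioo, Rat.cast_lt]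
    intro j
    have : (0 : ℚ) < 1 / 2 * (1 / 2 ^ j) := by positivity
    exact ⟨by linarith, by linarith⟩

/-- A real is not random if computable potentials of bounded growth have arbitrarily large
slopes near it. -/
theorem not_isMartinLofRandom_of_slope {b v : ℕ → ℚ} {β : ℝ} {C : ℕ} (hC : 0 < C)
    {A : ℕ → ℕ → ℚ → ℚ} (hb : ComputableRat b) (hbβ : ∀ n, (b n : ℝ) < β)
    (hv : ∀ n, v n - v 0 ≤ C)
    (hAc : ComputableRat (fun z : (ℕ × ℕ) × (ℕ × ℕ × ℕ) => A z.1.1 z.1.2 (ratVal z.2)))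
    (hA0 : ∀ j x, A j 0 x = 0) (hA : ∀ j n x, 0 ≤ A j n x) (hanti : ∀ j n, Antitone (A j n))
    (hstep : ∀ j n x, b (n + 1) ≤ x → A j (n + 1) x ≤ A j n x + (v (n + 1) - v n))
    (hslope : ∀ j, ∃ r₀ > β, ∃ N, ∀ n ≥ N, ∀ r : ℚ, β < r → (r : ℝ) < r₀ → ∀ p ≤ r,
      (C * 2 ^ j : ℚ) * (r - p) ≤ A j n p - A j n r) :
    ¬ IsMartinLofRandom β := by
  intro hβ
  -- Growth at most C against slope C·2^j leaves total length at most 2^(-j).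
  have hK : ComputableRat (fun j : ℕ => (C * 2 ^ j : ℚ)) :=
    (computableRat_const _).mul computableRat_two_pow
  have hfr := computableRat_coverEnd hb hK hAc
  have hl : ComputableRat (fun z : ℕ × ℕ =>
      max (coverEnd b (C * 2 ^ z.1) (A z.1) z.2) (b z.2)) := hfr.max (hb.comp Computable.snd)
  have hr : ComputableRat (fun z : ℕ × ℕ => coverEnd b (C * 2 ^ z.1) (A z.1) (z.2 + 1)) :=
    hfr.comp (φ := fun z : ℕ × ℕ => (z.1, z.2 + 1)) (Computable.fst.pair (Computable.succ.comp Computable.snd))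
  refine hβ _ (isMartinLofTest_of_sum_le hl hr (fun z => max_le_coverEnd_succ _) fun j n => ?_) ?_
  · have h := (coverEnd_sum_le (K := C * 2 ^ j) (hA0 j) (hA j) (hanti j)
      (hstep j) n).trans (hv n)
    have hC' : (0 : ℚ) < C := by exact_mod_cast hC
    rw [mul_assoc] at h
    exact le_of_mul_le_mul_left (by simpa using h) hC'
  · rw [Set.mem_iInter]
    intro j
    obtain ⟨r₀, hr₀, N, hN⟩ := hslope j
    have h := exists_coverEnd_covers (b := b) (K := C * 2 ^ j) (A := A j) hbβ hβ.ratCast_ne hr₀ hN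
    dsimp only
    rw [Set.mem_iUnion]
    exact h

/-! ### Optimal trading with a fee. -/

/-- The best fortunes, while holding a share and while holding none, of a trader who sells at time
`n` for `f n` and buys at time `n` for `f n + w * (x - b n)`. -/
def trade (f b : ℕ → ℚ) (w x : ℚ) : ℕ → ℚ × ℚ
  | 0 => (-(f 0 + w * (x - b 0)), 0)
  | n + 1 =>
    (max (trade f b w x n).1 ((trade f b w x n).2 - (f (n + 1) + w * (x - b (n + 1)))),
      max (trade f b w x n).2
        (max (trade f b w x n).1 ((trade f b w x n).2 - (f (n + 1) + w * (x - b (n + 1))))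
          + f (n + 1)))

def holdValue (f b : ℕ → ℚ) (w : ℚ) (n : ℕ) (x : ℚ) : ℚ := (trade f b w x n).1

def cashValue (f b : ℕ → ℚ) (w : ℚ) (n : ℕ) (x : ℚ) : ℚ := (trade f b w x n).2

section Trade

variable {f b v : ℕ → ℚ} {w : ℚ}

theorem holdValue_zero (x : ℚ) : holdValue f b w 0 x = -(f 0 + w * (x - b 0)) := rfl

theorem cashValue_zero (x : ℚ) : cashValue f b w 0 x = 0 := rfl

theorem holdValue_succ (n : ℕ) (x : ℚ) : holdValue f b w (n + 1) x =
    max (holdValue f b w n x) (cashValue f b w n x - (f (n + 1) + w * (x - b (n + 1)))) := rfl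

theorem cashValue_succ (n : ℕ) (x : ℚ) : cashValue f b w (n + 1) x =
    max (cashValue f b w n x) (holdValue f b w (n + 1) x + f (n + 1)) := rfl

theorem computableRat_cashValue {W : ℕ → ℚ} (hf : ComputableRat f) (hb : ComputableRat b)
    (hW : ComputableRat W) :
    ComputableRat (fun z : (ℕ × ℕ) × (ℕ × ℕ × ℕ) => cashValue f b (W z.1.1) z.1.2 (ratVal z.2)) := by
  have key := (computableRat_rec₂ (ι := ℕ × (ℕ × ℕ × ℕ))
    (F := fun i n => holdValue f b (W i.1) n (ratVal i.2))
    (G := fun i n => cashValue f b (W i.1) n (ratVal i.2))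
    (S := fun z c => max (ratVal c.1)
      (ratVal c.2 - (f (z.2 + 1) + W z.1.1 * (ratVal z.1.2 - b (z.2 + 1)))))
    (T := fun z c => max (ratVal c.2) (max (ratVal c.1)
      (ratVal c.2 - (f (z.2 + 1) + W z.1.1 * (ratVal z.1.2 - b (z.2 + 1)))) + f (z.2 + 1)))
    ?_ ?_ ?_ ?_ ?_ ?_).2
  · exact key.comp (φ := fun z : (ℕ × ℕ) × (ℕ × ℕ × ℕ) => ((z.1.1, z.2), z.1.2))
      (((Computable.fst.comp Computable.fst).pair Computable.snd).pair
        (Computable.snd.comp Computable.fst))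
  · exact ((computableRat_const _).add ((hW.comp Computable.fst).mul
      ((computableRat_ratVal Computable.snd).sub (computableRat_const _)))).neg
  · exact computableRat_const 0
  all_goals
    have hn : Computable
        (fun z : ((ℕ × (ℕ × ℕ × ℕ)) × ℕ) × ((ℕ × ℕ × ℕ) × (ℕ × ℕ × ℕ)) => z.1.2 + 1) :=
      Computable.succ.comp (Computable.snd.comp Computable.fst)
    have hc : ComputableRat
        (fun z : ((ℕ × (ℕ × ℕ × ℕ)) × ℕ) × ((ℕ × ℕ × ℕ) × (ℕ × ℕ × ℕ)) => ratVal z.2.1) :=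
      computableRat_ratVal (Computable.fst.comp Computable.snd)
    have hd : ComputableRat
        (fun z : ((ℕ × (ℕ × ℕ × ℕ)) × ℕ) × ((ℕ × ℕ × ℕ) × (ℕ × ℕ × ℕ)) => ratVal z.2.2) :=
      computableRat_ratVal (Computable.snd.comp Computable.snd)
    have hx : ComputableRat
        (fun z : ((ℕ × (ℕ × ℕ × ℕ)) × ℕ) × ((ℕ × ℕ × ℕ) × (ℕ × ℕ × ℕ)) => ratVal z.1.1.2) :=
      computableRat_ratVal (Computable.snd.comp (Computable.fst.comp Computable.fst))
    have hw : ComputableRat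
        (fun z : ((ℕ × (ℕ × ℕ × ℕ)) × ℕ) × ((ℕ × ℕ × ℕ) × (ℕ × ℕ × ℕ)) => W z.1.1.1) :=
      hW.comp (Computable.fst.comp (Computable.fst.comp Computable.fst))
    have hB := hc.max (hd.sub ((hf.comp hn).add (hw.mul (hx.sub (hb.comp hn)))))
    first
    | exact hB
    | exact hd.max (hB.add (hf.comp hn))
    | (intro i n c d h1 h2
       dsimp only at h1 h2 ⊢
       simp only [holdValue_succ, cashValue_succ, h1, h2])

theorem cashValue_le_succ (n : ℕ) (x : ℚ) : cashValue f b w n x ≤ cashValue f b w (n + 1) x :=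
  le_max_left _ _

theorem holdValue_le_succ (n : ℕ) (x : ℚ) : holdValue f b w n x ≤ holdValue f b w (n + 1) x :=
  le_max_left _ _

theorem monotone_cashValue (x : ℚ) : Monotone (fun n => cashValue f b w n x) :=
  monotone_nat_of_le_succ fun n => cashValue_le_succ n x

theorem monotone_holdValue (x : ℚ) : Monotone (fun n => holdValue f b w n x) :=
  monotone_nat_of_le_succ fun n => holdValue_le_succ n x

theorem cashValue_nonneg (n : ℕ) (x : ℚ) : 0 ≤ cashValue f b w n x :=
  monotone_cashValue x (Nat.zero_le n)

theorem holdValue_add_le_cashValue (hw : 0 ≤ w) (n : ℕ) {x : ℚ} (hx : b n ≤ x) :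
    holdValue f b w n x + f n ≤ cashValue f b w n x := by
  cases n with
  | zero =>
    rw [holdValue_zero, cashValue_zero]
    have := mul_nonneg hw (sub_nonneg.2 hx)
    linarith
  | succ n => exact le_max_right _ _

/-- A share already held appreciates by at most the increment of `v`; one bought at the new stage
and sold at once only loses the fee, which is nonnegative because b (n + 1) ≤ x. -/
theorem cashValue_succ_le (hw : 0 ≤ w) (hb : Monotone b) (hv : Monotone v)
    (hfv : ∀ n, f (n + 1) - f n ≤ v (n + 1) - v n) (n : ℕ) (x : ℚ) (hx : b (n + 1) ≤ x) :
    cashValue f b w (n + 1) x ≤ cashValue f b w n x + (v (n + 1) - v n) := by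
  have h0 := sub_nonneg.2 (hv n.le_succ)
  have h1 := holdValue_add_le_cashValue (f := f) hw n ((hb n.le_succ).trans hx)
  have h2 := mul_nonneg hw (sub_nonneg.2 hx)
  have h3 := hfv n
  rw [cashValue_succ, holdValue_succ]
  refine max_le (by linarith) ?_
  rw [← le_sub_iff_add_le]
  exact max_le (by linarith) (by linarith)

/-- The fortunes fall from `p` to `r` by at least `u` and `t` respectively. -/
def TradeDrop (f b : ℕ → ℚ) (w p r u t : ℚ) (n : ℕ) : Prop :=
  u ≤ cashValue f b w n p - cashValue f b w n r ∧ t ≤ holdValue f b w n p - holdValue f b w n r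

theorem tradeDrop_zero (p r : ℚ) : TradeDrop f b w p r 0 (w * (r - p)) 0 := by
  simp only [TradeDrop, cashValue_zero, holdValue_zero]
  constructor <;> linarith

/-- The two inequalities on `u` and `t` say that a sale preserves the bound for cash and a purchase
the bound for holding. -/
theorem TradeDrop.succ {p r u t : ℚ} {n : ℕ} (h : TradeDrop f b w p r u t n) (hut : u ≤ t)
    (htu : t ≤ u + w * (r - p)) : TradeDrop f b w p r u t (n + 1) := by
  obtain ⟨h1, h2⟩ := h
  have h3 : t ≤ holdValue f b w (n + 1) p - holdValue f b w (n + 1) r := by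
    have e1 := le_max_left (holdValue f b w n p)
      (cashValue f b w n p - (f (n + 1) + w * (p - b (n + 1))))
    have e2 := le_max_right (holdValue f b w n p)
      (cashValue f b w n p - (f (n + 1) + w * (p - b (n + 1))))
    rw [← holdValue_succ] at e1 e2
    rw [le_sub_comm, holdValue_succ n r]
    exact max_le (by linarith) (by linarith)
  refine ⟨?_, h3⟩
  have e1 := le_max_left (cashValue f b w n p) (holdValue f b w (n + 1) p + f (n + 1))
  have e2 := le_max_right (cashValue f b w n p) (holdValue f b w (n + 1) p + f (n + 1))
  rw [← cashValue_succ] at e1 e2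
  rw [le_sub_comm, cashValue_succ n r]
  exact max_le (by linarith) (by linarith)

theorem TradeDrop.mono {p r u t : ℚ} {m n : ℕ} (h : TradeDrop f b w p r u t m) (hut : u ≤ t)
    (htu : t ≤ u + w * (r - p)) (hmn : m ≤ n) : TradeDrop f b w p r u t n := by
  induction n, hmn using Nat.le_induction with
  | base => exact h
  | succ n _ ih => exact ih.succ hut htu

theorem exists_lt_succ_of_lt {F : ℕ → ℚ} {m n : ℕ} (hmn : m ≤ n) (h : F m < F n) :
    ∃ k, m ≤ k ∧ k < n ∧ F k < F (k + 1) := by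
  by_contra! H
  have : ∀ k, m ≤ k → k ≤ n → F k ≤ F m := by
    intro k hk
    induction k, hk using Nat.le_induction with
    | base => exact fun _ => le_rfl
    | succ k hk ih => exact fun hkn => (H k hk hkn).trans (ih (by omega))
  exact (this n hmn le_rfl).not_gt h

/-- The profitable round trip forces the optimal cash value at `r` to rise strictly at some stage.
There it results from a sale, and the same sale is open at `p`, so cash inherits the drop of the
holding value. -/
theorem TradeDrop.cash_gain {p r u t : ℚ} {m s n : ℕ} (h : TradeDrop f b w p r u t m)
    (hut : u ≤ t) (htu : t ≤ u + w * (r - p)) (hms : m < s) (hsn : s < n)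
    (hgain : f s + w * (r - b s) < f n) : TradeDrop f b w p r t t n := by
  have hlt : cashValue f b w m r < cashValue f b w n r := by
    obtain ⟨s, rfl⟩ : ∃ s', s = s' + 1 := ⟨s - 1, by omega⟩
    obtain ⟨n, rfl⟩ : ∃ n', n = n' + 1 := ⟨n - 1, by omega⟩
    have h1 : cashValue f b w m r ≤ cashValue f b w s r := monotone_cashValue r (by omega)
    have h2 : holdValue f b w (s + 1) r ≤ holdValue f b w (n + 1) r :=
      monotone_holdValue r (by omega)
    have h3 : cashValue f b w s r - (f (s + 1) + w * (r - b (s + 1))) ≤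
      holdValue f b w (s + 1) r := le_max_right _ _
    have h4 : holdValue f b w (n + 1) r + f (n + 1) ≤ cashValue f b w (n + 1) r :=
      le_max_right _ _
    linarith
  obtain ⟨k, hmk, hkn, hk⟩ := exists_lt_succ_of_lt (F := fun n => cashValue f b w n r)
    (hms.trans hsn).le hlt
  have hD := h.mono hut htu (n := k + 1) (by omega)
  have hD' : TradeDrop f b w p r t t (k + 1) := by
    refine ⟨?_, hD.2⟩
    have e : cashValue f b w (k + 1) r = holdValue f b w (k + 1) r + f (k + 1) := by
      rw [cashValue_succ] at hk ⊢
      exact max_eq_right ((lt_max_iff.1 hk).resolve_left (lt_irrefl _)).le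
    have e' : holdValue f b w (k + 1) p + f (k + 1) ≤ cashValue f b w (k + 1) p :=
      le_max_right _ _
    linarith [hD.2]
  exact hD'.mono le_rfl (by linarith) (by omega)

/-- Dually, selling dear and buying back cheap forces the holding value at `r` to rise, hence to
come from a purchase, which is cheaper at `p` by w(r - p). -/
theorem TradeDrop.hold_gain {p r u : ℚ} {m s n : ℕ} (h : TradeDrop f b w p r u u m)
    (hw : 0 ≤ w * (r - p)) (hms : m < s) (hsn : s < n)
    (hgain : f n + w * (r - b n) < f s) : TradeDrop f b w p r u (u + w * (r - p)) n := by
  have hlt : holdValue f b w m r < holdValue f b w n r := by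
    obtain ⟨s, rfl⟩ : ∃ s', s = s' + 1 := ⟨s - 1, by omega⟩
    obtain ⟨n, rfl⟩ : ∃ n', n = n' + 1 := ⟨n - 1, by omega⟩
    have h1 : holdValue f b w m r ≤ holdValue f b w (s + 1) r := monotone_holdValue r (by omega)
    have h2 : cashValue f b w (s + 1) r ≤ cashValue f b w n r :=
      monotone_cashValue r (by omega)
    have h3 : cashValue f b w n r - (f (n + 1) + w * (r - b (n + 1))) ≤
      holdValue f b w (n + 1) r := le_max_right _ _
    have h4 : holdValue f b w (s + 1) r + f (s + 1) ≤ cashValue f b w (s + 1) r :=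
      le_max_right _ _
    linarith
  obtain ⟨k, hmk, hkn, hk⟩ := exists_lt_succ_of_lt (F := fun n => holdValue f b w n r)
    (hms.trans hsn).le hlt
  have hD₀ := h.mono le_rfl (by linarith) (n := k) (by omega)
  have hD := h.mono le_rfl (by linarith) (n := k + 1) (by omega)
  have hD' : TradeDrop f b w p r u (u + w * (r - p)) (k + 1) := by
    refine ⟨hD.1, ?_⟩
    have e : holdValue f b w (k + 1) r =
        cashValue f b w k r - (f (k + 1) + w * (r - b (k + 1))) := by
      rw [holdValue_succ] at hk ⊢
      exact max_eq_right ((lt_max_iff.1 hk).resolve_left (lt_irrefl _)).le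
    have e' : cashValue f b w k p - (f (k + 1) + w * (p - b (k + 1))) ≤
        holdValue f b w (k + 1) p := le_max_right _ _
    linarith [hD₀.1]
  exact hD'.mono (by linarith) le_rfl (by omega)

theorem antitone_cashValue (hw : 0 ≤ w) (n : ℕ) : Antitone (cashValue f b w n) := by
  intro p r hpr
  have h := mul_nonneg hw (sub_nonneg.2 hpr)
  have := ((tradeDrop_zero (f := f) (b := b) (w := w) p r).mono h (by linarith) n.zero_le).1
  linarith

end Trade

/-! ### Convergence of the ratio of rates. -/

theorem IsLeftCEApprox.le {a : ℕ → ℚ} {α : ℝ} (ha : IsLeftCEApprox a α) (hm : Monotone a)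
    (n : ℕ) : (a n : ℝ) ≤ α :=
  Monotone.ge_of_tendsto (f := fun s => (a s : ℝ)) (Rat.cast_mono.comp hm)
    ha.tendsto n

theorem IsLeftCEApprox.lt {b : ℕ → ℚ} {β : ℝ} (hb : IsLeftCEApprox b β) (hm : Monotone b)
    (hβ : IsMartinLofRandom β) (n : ℕ) : (b n : ℝ) < β :=
  lt_of_le_of_ne (hb.le hm n) (hβ.ratCast_ne _)

theorem IsLeftCEApprox.of_monotone {a : ℕ → ℚ} {α : ℝ} (hc : ComputableRat a) (hm : Monotone a)
    (h : Tendsto (fun s => (a s : ℝ)) atTop (𝓝 α)) : IsLeftCEApprox a α :=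
  ⟨hc, h, Eventually.of_forall (Monotone.ge_of_tendsto (f := fun s => (a s : ℝ))
    (Rat.cast_mono.comp hm) h)⟩

theorem IsLeftCEApprox.exists_nat_bound {a : ℕ → ℚ} {α : ℝ} (ha : IsLeftCEApprox a α)
    (hm : Monotone a) : ∃ C : ℕ, 0 < C ∧ ∀ n, a n - a 0 ≤ C := by
  obtain ⟨C, hC⟩ := exists_nat_ge (α - a 0)
  refine ⟨C + 1, C.succ_pos, fun n => ?_⟩
  have : (a n : ℝ) - a 0 ≤ (C + 1 : ℕ) := by
    push_cast
    linarith [ha.le hm n]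
  exact_mod_cast this

/-- Every crossing of the gap between `f - b` and `f` raises the slope of the fortunes. -/
theorem exists_tradeDrop_of_oscillation {f b : ℕ → ℚ} {β y : ℝ}
    (hlow : ∃ᶠ s in atTop, (f s : ℝ) - b s < y - β) (hhigh : ∃ᶠ t in atTop, y < (f t : ℝ))
    (k : ℕ) : ∃ r₀ > β, ∃ N, ∀ n ≥ N, ∀ r : ℚ, (r : ℝ) < r₀ → ∀ p ≤ r,
      TradeDrop f b 1 p r (k * (r - p)) ((k + 1) * (r - p)) n := by
  induction k with
  | zero =>
    refine ⟨β + 1, by linarith, 0, fun n _ r _ p hpr => ?_⟩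
    have h := (tradeDrop_zero (f := f) (b := b) (w := 1) p r).mono (by linarith) (by linarith)
      n.zero_le
    simpa using h
  | succ k ih =>
    obtain ⟨r₀, hr₀, N, hN⟩ := ih
    -- Buy at `s` and sell at `t`, then sell at `t₁` and buy back at `s₁`. A second high stage is
    -- chosen because `hold_gain` needs its sale strictly after `t`.
    obtain ⟨s, hs, hs'⟩ := frequently_atTop.1 hlow (N + 1)
    obtain ⟨t, ht, ht'⟩ := frequently_atTop.1 hhigh (s + 1)
    obtain ⟨t₁, ht₁, ht₁'⟩ := frequently_atTop.1 hhigh (t + 1)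
    obtain ⟨s₁, hs₁, hs₁'⟩ := frequently_atTop.1 hlow (t₁ + 1)
    -- The two new bounds are the guesses at which the two trades break even; both exceed β.
    refine ⟨min r₀ (min (f t - f s + b s) (f t₁ - f s₁ + b s₁)), ?_, s₁, fun n hn r hr p hpr => ?_⟩
    · exact lt_min hr₀ (lt_min (by linarith) (by linarith))
    rw [lt_min_iff, lt_min_iff] at hr
    obtain ⟨hr1, hr2, hr3⟩ := hr
    have hr2' : f s + 1 * (r - b s) < f t := by
      have : r < f t - f s + b s := by exact_mod_cast hr2
      linarith
    have hr3' : f s₁ + 1 * (r - b s₁) < f t₁ := by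
      have : r < f t₁ - f s₁ + b s₁ := by exact_mod_cast hr3
      linarith
    have h1 := (hN N le_rfl r hr1 p hpr).cash_gain (by linarith) (by linarith)
      (by omega : N < s) (by omega : s < t) hr2'
    have h2 := h1.hold_gain (by linarith) (by omega : t < t₁) (by omega : t₁ < s₁) hr3'
    have h3 := h2.mono (by linarith) (by linarith) hn
    push_cast
    convert h3 using 1
    ring

section Approximations

variable {a b : ℕ → ℚ} {α β : ℝ}

/-- With f = a - c·b and y = α - cβ, the two hypotheses say that at x = β the purchase price is
often below y and the sale price often above it. As c ≥ 0, f rises no faster than a. -/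
theorem not_oscillating_unit_gap (hβ : IsMartinLofRandom β) (ha : IsLeftCEApprox a α)
    (ham : Monotone a) (hb : IsLeftCEApprox b β) (hbm : Monotone b) {c : ℚ} (hc : 0 ≤ c)
    (hlow : ∃ᶠ s in atTop, (c + 1) * (β - b s) < α - a s)
    (hhigh : ∃ᶠ s in atTop, α - a s < c * (β - b s)) : False := by
  obtain ⟨C, hC, hCa⟩ := ha.exists_nat_bound ham
  have hf : ComputableRat (fun n => a n - c * b n) :=
    ha.computable.sub ((computableRat_const c).mul hb.computable)
  refine not_isMartinLofRandom_of_slope hC hb.computable (hb.lt hbm hβ) hCa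
    (A := fun _ => cashValue (fun n => a n - c * b n) b 1)
    (computableRat_cashValue hf hb.computable (computableRat_const 1))
    (fun _ => cashValue_zero) (fun _ => cashValue_nonneg)
    (fun _ => antitone_cashValue zero_le_one) (fun _ => cashValue_succ_le zero_le_one hbm ham
      fun n => ?_) (fun j => ?_) hβ
  · have := mul_nonneg hc (sub_nonneg.2 (hbm n.le_succ))
    simp only [Nat.succ_eq_add_one] at this
    linarith
  · obtain ⟨r₀, hr₀, N, hN⟩ := exists_tradeDrop_of_oscillation
      (f := fun n => a n - c * b n) (b := b) (β := β) (y := α - c * β)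
      (hlow.mono fun s hs => by push_cast; linarith)
      (hhigh.mono fun s hs => by push_cast; linarith) (C * 2 ^ j)
    refine ⟨r₀, hr₀, N, fun n hn r _ hr p hp => ?_⟩
    have := (hN n hn r hr p hp).1
    push_cast at this
    exact this

/-- Dividing `a` by d - c turns the gap into one of length 1. -/
theorem not_oscillating (hβ : IsMartinLofRandom β) (ha : IsLeftCEApprox a α)
    (ham : Monotone a) (hb : IsLeftCEApprox b β) (hbm : Monotone b) {c d : ℚ} (hc : 0 ≤ c)
    (hcd : c < d) (hlow : ∃ᶠ s in atTop, d * (β - b s) < α - a s)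
    (hhigh : ∃ᶠ s in atTop, α - a s < c * (β - b s)) : False := by
  have he : 0 < d - c := sub_pos.2 hcd
  have he' : (0 : ℝ) < d - c := by exact_mod_cast he
  have hm : Monotone (fun n => 1 / (d - c) * a n) := ham.const_mul (by positivity)
  refine not_oscillating_unit_gap hβ (a := fun n => 1 / (d - c) * a n)
    (α := 1 / (d - c) * α) (c := 1 / (d - c) * c) (.of_monotone
      ((computableRat_const _).mul ha.computable) hm ?_) hm hb hbm (by positivity)
    (hlow.mono fun s hs => ?_) (hhigh.mono fun s hs => ?_)
  · simpa using ha.tendsto.const_mul (1 / ((d : ℝ) - c))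
  · have h := mul_lt_mul_of_pos_left hs (one_div_pos.2 he')
    have h1 : 1 / ((d : ℝ) - c) * d = 1 / (d - c) * c + 1 := by field_simp; ring
    push_cast
    rw [← h1]
    linarith
  · have h := mul_lt_mul_of_pos_left hs (one_div_pos.2 he')
    push_cast
    linarith

/-- Steepness here comes from the fee weight C·2^j rather than from the number of trades: an
unbounded ratio makes one round trip profitable at any weight. -/
theorem exists_eventually_le_mul (hβ : IsMartinLofRandom β) (ha : IsLeftCEApprox a α)
    (ham : Monotone a) (hb : IsLeftCEApprox b β) (hbm : Monotone b) :
    ∃ K : ℕ, ∀ᶠ s in atTop, α - a s ≤ K * (β - b s) := by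
  by_contra! H
  obtain ⟨C, hC, hCa⟩ := ha.exists_nat_bound ham
  have hW : ComputableRat (fun j : ℕ => (C * 2 ^ j : ℚ)) :=
    (computableRat_const _).mul computableRat_two_pow
  have hW0 : ∀ j : ℕ, (0 : ℚ) < C * 2 ^ j := fun j => by positivity
  refine not_isMartinLofRandom_of_slope hC hb.computable (hb.lt hbm hβ) hCa
    (A := fun j => cashValue a b (C * 2 ^ j))
    (computableRat_cashValue ha.computable hb.computable hW)
    (fun _ => cashValue_zero) (fun _ => cashValue_nonneg)
    (fun j => antitone_cashValue (hW0 j).le) (fun j => cashValue_succ_le (hW0 j).le hbm ham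
      fun n => le_rfl) (fun j => ?_) hβ
  have hw : (0 : ℝ) < C * 2 ^ j := by exact_mod_cast hW0 j
  -- Stage 0 is excluded because `cash_gain` buys strictly after its starting stage.
  obtain ⟨s, hs, hs'⟩ := frequently_atTop.1 (H (C * 2 ^ j)) 1
  push_cast at hs'
  have hlim : ∀ᶠ n in atTop, (a s : ℝ) + C * 2 ^ j * (β - b s) < a n :=
    ha.tendsto.eventually (lt_mem_nhds (by linarith))
  obtain ⟨t, ht, hst⟩ := (hlim.and (eventually_gt_atTop s)).exists
  refine ⟨((a t : ℝ) - a s) / (C * 2 ^ j) + b s, ?_, t, fun n hn r _ hr p hp => ?_⟩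
  · rw [gt_iff_lt, ← sub_lt_iff_lt_add, lt_div_iff₀ hw]
    linarith
  · rw [← sub_lt_iff_lt_add, lt_div_iff₀ hw] at hr
    have hr' : (r - b s) * (C * 2 ^ j) < a t - a s := by exact_mod_cast hr
    have hp0 := mul_nonneg (hW0 j).le (sub_nonneg.2 hp)
    exact (((tradeDrop_zero p r).cash_gain hp0 (by linarith) (by omega : 0 < s) hst
      (by linarith)).mono le_rfl (by linarith) hn).1

theorem ratio_nonneg (ha : IsLeftCEApprox a α)
    (ham : Monotone a) (hb : IsLeftCEApprox b β) (hbm : Monotone b) (n : ℕ) :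
    0 ≤ (α - a n) / (β - b n) :=
  div_nonneg (sub_nonneg.2 (ha.le ham n)) (sub_nonneg.2 (hb.le hbm n))

theorem exists_tendsto_ratio (hβ : IsMartinLofRandom β) (ha : IsLeftCEApprox a α)
    (ham : Monotone a) (hb : IsLeftCEApprox b β) (hbm : Monotone b) :
    ∃ L, Tendsto (fun s => (α - (a s : ℝ)) / (β - (b s : ℝ))) atTop (𝓝 L) := by
  have hpos : ∀ n, 0 < β - b n := fun n => sub_pos.2 (hb.lt hbm hβ n)
  obtain ⟨K, hK⟩ := exists_eventually_le_mul hβ ha ham hb hbm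
  refine tendsto_of_no_upcrossings (s := Set.range ((↑) : ℚ → ℝ)) Rat.denseRange_cast ?_
    ⟨K, ?_⟩ ⟨0, ?_⟩
  · rintro _ ⟨c, rfl⟩ _ ⟨d, rfl⟩ hcd ⟨h1, h2⟩
    have hc : (0 : ℝ) ≤ c := by
      obtain ⟨n, hn⟩ := h1.exists
      exact (ratio_nonneg ha ham hb hbm n).trans hn.le
    exact not_oscillating hβ ha ham hb hbm (by exact_mod_cast hc) (by exact_mod_cast hcd)
      (h2.mono fun s hs => (lt_div_iff₀ (hpos s)).1 hs)
      (h1.mono fun s hs => (div_lt_iff₀ (hpos s)).1 hs)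
  · exact eventually_map.2 (hK.mono fun s hs => (div_le_iff₀ (hpos s)).2 hs)
  · exact eventually_map.2 (Eventually.of_forall (ratio_nonneg ha ham hb hbm))

end Approximations

/-- A left-c.e. approximation need not be monotone. -/
theorem IsLeftCEApprox.isLeftCE {d : ℕ → ℚ} {δ : ℝ} (hd : IsLeftCEApprox d δ) : IsLeftCE δ := by
  obtain ⟨N, hN⟩ := eventually_atTop.1 hd.eventually_le
  have hd' : ComputableRat (fun n => d (n + N)) :=
    hd.computable.comp (computable_nat_add Computable.id (Computable.const N))
  have hc : ComputableRat (partialSups fun n => d (n + N)) := by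
    have h := computableRat_rec (ι := Unit) (F := fun _ => partialSups fun n => d (n + N))
      (S := fun z c => max (ratVal c) (d (z.2 + 1 + N))) (computableRat_const _)
      ((computableRat_ratVal Computable.snd).max
        (hd'.comp (Computable.succ.comp (Computable.snd.comp Computable.fst))))
      (fun _ n c h => by dsimp only at h ⊢; rw [partialSups_add_one, h])
    exact h.comp (φ := fun n : ℕ => ((), n)) ((Computable.const ()).pair Computable.id)
  refine ⟨_, .of_monotone hc (partialSups _).monotone ?_, (partialSups _).monotone⟩
  refine tendsto_of_tendsto_of_tendsto_of_le_of_le ((tendsto_add_atTop_iff_nat N).2 hd.tendsto)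
    tendsto_const_nhds (fun n => ?_) (fun n => ?_)
  · exact Rat.cast_le.2 (le_partialSups (fun n => d (n + N)) n)
  · induction n with
    | zero => simpa using hN N le_rfl
    | succ n ih =>
      dsimp only at ih ⊢
      rw [partialSups_add_one, Rat.cast_max]
      exact max_le ih (hN _ (by omega))

/-! ### Independence of the approximation, and identification of the limit. -/

/-- The last stage `t ≤ s` found so far at which the sequence `b` had overtaken the previous such
value of `b'`. -/
def catchUp (b b' : ℕ → ℚ) : ℕ → ℕ
  | 0 => 0
  | s + 1 => bif decide (b' (catchUp b b' s) ≤ b s) then s + 1 else catchUp b b' s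

section CatchUp

variable {b b' : ℕ → ℚ}

theorem catchUp_succ_of_le {s : ℕ} (h : b' (catchUp b b' s) ≤ b s) :
    catchUp b b' (s + 1) = s + 1 := by
  simp [catchUp, h]

theorem catchUp_succ_of_not_le {s : ℕ} (h : ¬ b' (catchUp b b' s) ≤ b s) :
    catchUp b b' (s + 1) = catchUp b b' s := by
  simp [catchUp, h]

theorem computable_catchUp (hb : ComputableRat b) (hb' : ComputableRat b') :
    Computable (catchUp b b') := by
  have hm : Computable (fun z : (Unit × ℕ) × ℕ => z.1.2) := Computable.snd.comp Computable.fst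
  have h := computable_rec (ι := Unit) (σ := ℕ) (F0 := fun _ => 0)
    (S := fun z => bif decide (b' z.2 ≤ b z.1.2) then z.1.2 + 1 else z.2) (Computable.const 0)
    (Computable.cond ((hb'.comp Computable.snd).decide_le (hb.comp hm))
      (Computable.succ.comp hm) Computable.snd)
  refine (h.comp ((Computable.const ()).pair Computable.id)).of_eq fun n => ?_
  induction n with
  | zero => rfl
  | succ n ih =>
    simp only [id] at ih ⊢
    rw [catchUp, ih]

theorem catchUp_le (s : ℕ) : catchUp b b' s ≤ s := by
  induction s with
  | zero => exact le_rfl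
  | succ s ih =>
    by_cases h : b' (catchUp b b' s) ≤ b s
    · exact (catchUp_succ_of_le h).le
    · exact (catchUp_succ_of_not_le h).le.trans (ih.trans s.le_succ)

theorem monotone_catchUp : Monotone (catchUp b b') := by
  refine monotone_nat_of_le_succ fun s => ?_
  by_cases h : b' (catchUp b b' s) ≤ b s
  · exact ((catchUp_le s).trans s.le_succ).trans (catchUp_succ_of_le h).ge
  · exact (catchUp_succ_of_not_le h).ge

theorem frequently_catchUp_le {β : ℝ} (hb : Tendsto (fun s => (b s : ℝ)) atTop (𝓝 β))
    (hb' : ∀ n, (b' n : ℝ) < β) : ∃ᶠ s in atTop, b' (catchUp b b' s) ≤ b s := by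
  refine frequently_atTop.2 fun N => ?_
  by_contra! H
  have hconst : ∀ s ≥ N, catchUp b b' s = catchUp b b' N := by
    intro s hs
    induction s, hs using Nat.le_induction with
    | base => rfl
    | succ s hs ih => rw [catchUp_succ_of_not_le (H s hs).not_ge, ih]
  obtain ⟨s, hs, hsN⟩ := ((hb.eventually (lt_mem_nhds (hb' (catchUp b b' N)))).and
    (eventually_ge_atTop N)).exists
  have := H s hsN
  rw [hconst s hsN] at this
  exact absurd (Rat.cast_lt (K := ℝ).2 this) hs.not_gt

theorem frequently_catchUp_eq {β : ℝ} (hb : Tendsto (fun s => (b s : ℝ)) atTop (𝓝 β))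
    (hb' : ∀ n, (b' n : ℝ) < β) : ∃ᶠ s in atTop, catchUp b b' s = s := by
  refine frequently_atTop.2 fun N => ?_
  obtain ⟨s, hs, h⟩ := frequently_atTop.1 (frequently_catchUp_le hb hb') N
  exact ⟨s + 1, by omega, catchUp_succ_of_le h⟩

end CatchUp

section Ratio

variable {a b b' : ℕ → ℚ} {α β : ℝ}

/-- Delay `b'` along `catchUp`. The delayed ratio still converges; it is at least 1 whenever `b` has
caught up, and agrees with the original ratio at the infinitely many stages without delay. -/
theorem one_le_of_tendsto_ratio (hβ : IsMartinLofRandom β) (hb : IsLeftCEApprox b β)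
    (hbm : Monotone b) (hb' : IsLeftCEApprox b' β) (hbm' : Monotone b') {L : ℝ}
    (hL : Tendsto (fun s => (β - (b' s : ℝ)) / (β - (b s : ℝ))) atTop (𝓝 L)) : 1 ≤ L := by
  have hlt := hb'.lt hbm' hβ
  have hσ : Tendsto (catchUp b b') atTop atTop := tendsto_atTop_atTop_of_monotone monotone_catchUp
    fun N => by
      obtain ⟨s, hs, h⟩ := frequently_atTop.1 (frequently_catchUp_eq hb.tendsto hlt) N
      exact ⟨s, h.symm ▸ hs⟩
  have hm : Monotone (fun s => b' (catchUp b b' s)) := hbm'.comp monotone_catchUp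
  have hc : IsLeftCEApprox (fun s => b' (catchUp b b' s)) β :=
    .of_monotone (hb'.computable.comp (computable_catchUp hb.computable hb'.computable)) hm
      (hb'.tendsto.comp hσ)
  obtain ⟨L', hL'⟩ := exists_tendsto_ratio hβ hc hm hb hbm
  have h1 : 1 ≤ L' := ge_of_tendsto_of_frequently hL'
    ((frequently_catchUp_le hb.tendsto hlt).mono fun s hs => by
      rw [one_le_div (sub_pos.2 (hb.lt hbm hβ s))]
      exact sub_le_sub_left (Rat.cast_le.2 hs) β)
  have h2 : L' = L := tendsto_nhds_unique_of_frequently_eq hL' hL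
    ((frequently_catchUp_eq hb.tendsto hlt).mono fun s hs => by rw [hs])
  exact h2 ▸ h1

/-- All monotone approximations of a random left-c.e. real converge at the same rate. -/
theorem tendsto_ratio_one (hβ : IsMartinLofRandom β) (hb : IsLeftCEApprox b β)
    (hbm : Monotone b) (hb' : IsLeftCEApprox b' β) (hbm' : Monotone b') :
    Tendsto (fun s => (β - (b' s : ℝ)) / (β - (b s : ℝ))) atTop (𝓝 1) := by
  obtain ⟨L, hL⟩ := exists_tendsto_ratio hβ hb' hbm' hb hbm
  obtain ⟨M, hM⟩ := exists_tendsto_ratio hβ hb hbm hb' hbm'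
  have h1 := one_le_of_tendsto_ratio hβ hb hbm hb' hbm' hL
  have h2 := one_le_of_tendsto_ratio hβ hb' hbm' hb hbm hM
  have hLM : L * M = 1 := by
    refine tendsto_nhds_unique ((hL.mul hM).congr fun s => ?_) tendsto_const_nhds
    have e1 := sub_pos.2 (hb.lt hbm hβ s)
    have e2 := sub_pos.2 (hb'.lt hbm' hβ s)
    field_simp
  have : L = 1 := by nlinarith
  exact this ▸ hL

theorem mem_leftCEFactors_of_lt (hβ : IsMartinLofRandom β) (ha : IsLeftCEApprox a α)
    (hb : IsLeftCEApprox b β) (hbm : Monotone b) {L : ℝ}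
    (hL : Tendsto (fun s => (α - (a s : ℝ)) / (β - (b s : ℝ))) atTop (𝓝 L)) {q : ℚ} (hq : 0 < q)
    (hLq : L < q) : (q : ℝ) ∈ leftCEFactors α β := by
  refine ⟨q, hq, IsLeftCEApprox.isLeftCE (d := fun s => q * b s - a s)
    ⟨((computableRat_const q).mul hb.computable).sub ha.computable, ?_, ?_⟩, rfl⟩
  · simpa using (hb.tendsto.const_mul (q : ℝ)).sub ha.tendsto
  · filter_upwards [hL.eventually (gt_mem_nhds hLq)] with s hs
    rw [div_lt_iff₀ (sub_pos.2 (hb.lt hbm hβ s))] at hs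
    push_cast
    linarith

/-- If `d` increases to qβ - α, then (a + d)/q is a monotone approximation of β, so q(β - (a +
d)/q)/(β - b) tends to q. Its numerator is (α - a) + (qβ - α - d), which is at least α - a. -/
theorem le_of_mem_leftCEFactors (hβ : IsMartinLofRandom β) (ha : IsLeftCEApprox a α)
    (ham : Monotone a) (hb : IsLeftCEApprox b β) (hbm : Monotone b) {L : ℝ}
    (hL : Tendsto (fun s => (α - (a s : ℝ)) / (β - (b s : ℝ))) atTop (𝓝 L)) {x : ℝ}
    (hx : x ∈ leftCEFactors α β) : L ≤ x := by
  obtain ⟨q, hq, ⟨d, hd, hdm⟩, rfl⟩ := hx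
  have hq' : (0 : ℝ) < q := by exact_mod_cast hq
  have hm : Monotone (fun s => 1 / q * (a s + d s)) :=
    (ham.add hdm).const_mul (by positivity)
  have hc : IsLeftCEApprox (fun s => 1 / q * (a s + d s)) β := by
    refine .of_monotone ((computableRat_const _).mul (ha.computable.add hd.computable)) hm ?_
    have h := (ha.tendsto.add hd.tendsto).const_mul (1 / (q : ℝ))
    have e : 1 / (q : ℝ) * (α + (q * β - α)) = β := by field_simp; ring
    rw [e] at h
    simpa using h
  have h1 := (tendsto_ratio_one hβ hb hbm hc hm).const_mul (q : ℝ)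
  rw [mul_one] at h1
  refine le_of_tendsto_of_tendsto' hL h1 fun s => ?_
  rw [← mul_div_assoc]
  refine div_le_div_of_nonneg_right ?_ (sub_pos.2 (hb.lt hbm hβ s)).le
  push_cast
  have e : (q : ℝ) * (β - 1 / q * (a s + d s)) = q * β - (a s + d s) := by field_simp
  rw [e]
  linarith [hd.le hdm s]

theorem leftCEFactors_nonempty (hβ : IsMartinLofRandom β) (hα' : IsLeftCE α) (hβ' : IsLeftCE β) :
    (leftCEFactors α β).Nonempty := by
  obtain ⟨a, ha, ham⟩ := hα'
  obtain ⟨b, hb, hbm⟩ := hβ'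
  obtain ⟨L, hL⟩ := exists_tendsto_ratio hβ ha ham hb hbm
  obtain ⟨q, hq⟩ := exists_rat_gt (max L 0)
  rw [max_lt_iff] at hq
  exact ⟨q, mem_leftCEFactors_of_lt hβ ha hb hbm hL (by exact_mod_cast hq.2) hq.1⟩

theorem tendsto_ratio_calD (hβ : IsMartinLofRandom β) (ha : IsLeftCEApprox a α)
    (ham : Monotone a) (hb : IsLeftCEApprox b β) (hbm : Monotone b) :
    Tendsto (fun s => (α - (a s : ℝ)) / (β - (b s : ℝ))) atTop (𝓝 (calD α β)) := by
  obtain ⟨L, hL⟩ := exists_tendsto_ratio hβ ha ham hb hbm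
  have hL0 : 0 ≤ L := ge_of_tendsto' hL (ratio_nonneg ha ham hb hbm)
  have hle : ∀ x ∈ leftCEFactors α β, L ≤ x := fun x =>
    le_of_mem_leftCEFactors hβ ha ham hb hbm hL
  have e : calD α β = L := by
    refine le_antisymm (le_of_forall_gt_imp_ge_of_dense fun y hy => ?_)
      (le_csInf (leftCEFactors_nonempty hβ ⟨a, ha, ham⟩ ⟨b, hb, hbm⟩) hle)
    obtain ⟨q, hq, hqy⟩ := exists_rat_btwn hy
    exact (csInf_le ⟨L, hle⟩ (mem_leftCEFactors_of_lt hβ ha hb hbm hL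
      (by exact_mod_cast hL0.trans_lt hq) hq)).trans hqy.le
  rwa [e]

end Ratio

/-! ### Algebraic laws and the main theorem. -/

theorem calD_add {α β γ : ℝ} (hγ : IsMartinLofRandom γ) (hα' : IsLeftCE α) (hβ' : IsLeftCE β)
    (hγ' : IsLeftCE γ) : calD (α + β) γ = calD α γ + calD β γ := by
  obtain ⟨a, ha, ham⟩ := hα'
  obtain ⟨b, hb, hbm⟩ := hβ'
  obtain ⟨c, hc, hcm⟩ := hγ'
  have hab : IsLeftCEApprox (fun s => a s + b s) (α + β) :=
    .of_monotone (ha.computable.add hb.computable) (ham.add hbm)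
      (by simpa using ha.tendsto.add hb.tendsto)
  refine tendsto_nhds_unique (tendsto_ratio_calD hγ hab (ham.add hbm) hc hcm)
    (((tendsto_ratio_calD hγ ha ham hc hcm).add (tendsto_ratio_calD hγ hb hbm hc hcm)).congr
      fun s => ?_)
  rw [← add_div]
  push_cast
  ring

theorem calD_mul_comm_eq_one {α β : ℝ} (hα : IsMartinLofRandom α) (hβ : IsMartinLofRandom β)
    (hα' : IsLeftCE α) (hβ' : IsLeftCE β) : calD α β * calD β α = 1 := by
  obtain ⟨a, ha, ham⟩ := hα'
  obtain ⟨b, hb, hbm⟩ := hβ'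
  refine tendsto_nhds_unique (((tendsto_ratio_calD hβ ha ham hb hbm).mul
    (tendsto_ratio_calD hα hb hbm ha ham)).congr fun s => ?_) tendsto_const_nhds
  have e1 := sub_pos.2 (ha.lt ham hα s)
  have e2 := sub_pos.2 (hb.lt hbm hβ s)
  field_simp

theorem calD_nonneg (α β : ℝ) : 0 ≤ calD α β :=
  Real.sInf_nonneg fun _ ⟨_, hq, _, hx⟩ => hx ▸ (Rat.cast_nonneg.2 hq.le)

-- Comparing the sets of factors directly avoids proving that qβ is random, which the limit formula
-- would require.
open scoped Pointwise in
theorem calD_mul_right (α β : ℝ) {q : ℚ} (hq : 0 < q) :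
    calD α (q * β) = 1 / q * calD α β := by
  have hq' : (q : ℝ) ≠ 0 := by exact_mod_cast hq.ne'
  have h : leftCEFactors α (q * β) = (1 / q : ℝ) • leftCEFactors α β := by
    ext x
    rw [Set.mem_smul_set]
    constructor
    · rintro ⟨p, hp, h, rfl⟩
      refine ⟨((p * q : ℚ) : ℝ), ⟨p * q, mul_pos hp hq, ?_, rfl⟩, ?_⟩
      · convert h using 1
        push_cast
        ring
      · push_cast
        rw [smul_eq_mul]
        field_simp
    · rintro ⟨_, ⟨p, hp, h, rfl⟩, rfl⟩
      refine ⟨p / q, div_pos hp hq, ?_, ?_⟩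
      · convert h using 1
        push_cast
        field_simp
      · push_cast
        rw [smul_eq_mul]
        ring
  rw [calD, h, Real.sInf_smul_of_nonneg (by positivity), smul_eq_mul, calD]

theorem calD_mul_left {α β : ℝ} (hβ : IsMartinLofRandom β) (hα' : IsLeftCE α) (hβ' : IsLeftCE β)
    {q : ℚ} (hq : 0 < q) : calD (q * α) β = q * calD α β := by
  obtain ⟨a, ha, ham⟩ := hα'
  obtain ⟨b, hb, hbm⟩ := hβ'
  have hm : Monotone (fun s => q * a s) := ham.const_mul hq.le
  have hc : IsLeftCEApprox (fun s => q * a s) (q * α) :=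
    .of_monotone ((computableRat_const q).mul ha.computable) hm
      (by simpa using ha.tendsto.const_mul (q : ℝ))
  refine tendsto_nhds_unique (tendsto_ratio_calD hβ hc hm hb hbm)
    (((tendsto_ratio_calD hβ ha ham hb hbm).const_mul (q : ℝ)).congr fun s => ?_)
  push_cast
  ring

theorem theorem1p6 (α β : ℝ)
    (hα : IsMartinLofRandom α) (hα' : IsLeftCE α)
    (hβ : IsMartinLofRandom β) (hβ' : IsLeftCE β) :
    -- the infimum is over a nonempty set and is positive
    ((leftCEFactors α β).Nonempty ∧ 0 < calD α β) ∧
    -- the ratio of the rates of convergence tends to it, for all monotone approximations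
    (∀ a b : ℕ → ℚ, IsLeftCEApprox a α → Monotone a → IsLeftCEApprox b β → Monotone b →
      Tendsto (fun s => (α - (a s : ℝ)) / (β - (b s : ℝ))) atTop (𝓝 (calD α β))) ∧
    -- additivity, scaling, inversion
    (∀ γ : ℝ, IsMartinLofRandom γ → IsLeftCE γ →
      calD (α + β) γ = calD α γ + calD β γ) ∧
    (∀ q : ℚ, 0 < q →
      calD α ((q : ℝ) * β) = 1 / (q : ℝ) * calD α β ∧
      calD ((q : ℝ) * α) β = (q : ℝ) * calD α β) ∧
    calD α β * calD β α = 1 := by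
  have hinv := calD_mul_comm_eq_one hα hβ hα' hβ'
  refine ⟨⟨leftCEFactors_nonempty hβ hα' hβ', (calD_nonneg α β).lt_of_ne' fun h => ?_⟩,
    fun a b ha ham hb hbm => tendsto_ratio_calD hβ ha ham hb hbm,
    fun γ hγ hγ' => calD_add hγ hα' hβ' hγ',
    fun q hq => ⟨calD_mul_right α β hq, calD_mul_left hβ hα' hβ' hq⟩, hinv⟩
  rw [h, zero_mul] at hinv
  exact zero_ne_one hinv
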